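/- Let $p\in\mathbb{C}[z]$ be a monic cubic polynomial with three distinct roots. One step of the Gauss–Seidel variant of the Weierstrass method for $p$ is the following operation on $\mathbb{C}^3$: given $(z_1,z_2,z_3)$, for $i=1,2,3$ in this order, replace $$z_i \;\leftarrow\; z_i-\frac{p(z_i)}{\prod_{j\neq i}(z_i-z_j)},$$ where each replacement uses the current values of all coordinates (so already updated values are used for later coordinates); the step is well defined at $(z_1,z_2,z_3)$ if none of the three denominators that occur vanishes. Denote the resulting partial map by $\operatorname{GSW}_p\colon\mathbb{C}^3\dashrightarrow\mathbb{C}^3$. Then $\operatorname{GSW}_p$ has an orbit that goes to infinity in every coordinate: there is an infinite sequence $z^{(0)},z^{(1)},z^{(2)},\dots$ in $\mathbb{C}^3$ such that, for every $k\ge 0$, $\operatorname{GSW}_p$ is well defined at $z^{(k)}$ and $z^{(k+1)}=\operatorname{GSW}_p(z^{(k)})$, and such that $|z^{(k)}_i|\to\infty$ as $k\to\infty$ for each $i\in\{1,2,3\}$. -/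

import Mathlib

open Polynomial

/-- The Weierstrass update of the `i`-th coordinate of the approximation vector `z`:
`z_i - p(z_i) / ∏_{j ≠ i} (z_i - z_j)`.
It is meaningful only where the denominator does not vanish, see `gswDefinedAt`. -/
noncomputable def weierstrassUpdate {n : ℕ} (p : ℂ[X]) (z : Fin n → ℂ) (i : Fin n) : ℂ :=
  z i - p.eval (z i) / ∏ j ∈ Finset.univ.erase i, (z i - z j)

/-- The approximation vector inside one Gauss–Seidel sweep after the first `k` coordinates have
been overwritten, in order, by their Weierstrass updates; each update uses the current
(already overwritten) values. -/
noncomputable def gswStage {n : ℕ} (p : ℂ[X]) (z : Fin n → ℂ) : ℕ → (Fin n → ℂ)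
  | 0 => z
  | k + 1 =>
    if h : k < n then
      Function.update (gswStage p z k) ⟨k, h⟩ (weierstrassUpdate p (gswStage p z k) ⟨k, h⟩)
    else gswStage p z k

/-- One step of the Gauss–Seidel variant of the Weierstrass method: a full sweep over all `n`
coordinates. -/
noncomputable def gsw {n : ℕ} (p : ℂ[X]) (z : Fin n → ℂ) : Fin n → ℂ :=
  gswStage p z n

/-- The Gauss–Seidel Weierstrass step is well defined at `z`: no division by zero occurs in the
sweep, i.e. when the `i`-th coordinate is about to be updated, it differs from every other current
coordinate. -/
def gswDefinedAt {n : ℕ} (p : ℂ[X]) (z : Fin n → ℂ) : Prop :=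
  ∀ i j : Fin n, j ≠ i → gswStage p z i i ≠ gswStage p z i j

/-- `z 0, z 1, z 2, …` is an infinite forward orbit of the Gauss–Seidel Weierstrass method, along
which every step is well defined. -/
def IsGSWOrbit {n : ℕ} (p : ℂ[X]) (z : ℕ → Fin n → ℂ) : Prop :=
  ∀ k : ℕ, gswDefinedAt p (z k) ∧ z (k + 1) = gsw p (z k)

/-! A sweep is three steps of the scalar recurrence `(w n - w (n+1)) * (w n - w (n+2)) * (w n - w
(n+3)) = p (w n)`. Near infinity only the cubic term of `p` matters, and for `z ^ 3` the sequence `μ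
^ n` is an exact solution when `(1 - μ) * (1 - μ ^ 2) * (1 - μ ^ 3) = 1`; `exists_ratio` finds such
a `μ` outside the unit disk. For general `p`, put `w n = μ ^ (N + n) + f n`. Solved for its earliest
term, the equation for `f` is an affine contraction of the later terms plus an error of order `μ ^
(-(N + n))`. For large `N`, Banach's theorem on bounded sequences gives a bounded `f`, so `w`
escapes like `μ ^ n`. -/

/-! ### Bounded solutions of implicit forward recurrences -/

/-- If every `Φ n` maps a closed ball of radius `R` in `ℂ⁴` into the disk of radius `R` and is
uniformly contracting there, then `f n = Φ n (f n, f (n + 1), f (n + 2), f (n + 3))` has a solution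
bounded by `R`. -/
theorem exists_bounded_solution_of_contracting {K R : ℝ} (hK : 0 ≤ K) (hK1 : K < 1) (hR : 0 ≤ R)
    (Φ : ℕ → (Fin 4 → ℂ) → ℂ)
    (hmaps : ∀ n, ∀ v ∈ Metric.closedBall (0 : Fin 4 → ℂ) R, ‖Φ n v‖ ≤ R)
    (hlip : ∀ n, ∀ v ∈ Metric.closedBall (0 : Fin 4 → ℂ) R,
      ∀ w ∈ Metric.closedBall (0 : Fin 4 → ℂ) R, ‖Φ n v - Φ n w‖ ≤ K * ‖v - w‖) :
    ∃ f : ℕ → ℂ, (∀ n, ‖f n‖ ≤ R) ∧ ∀ n, f n = Φ n (fun k => f (n + k)) := by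
  let S : Set (BoundedContinuousFunction ℕ ℂ) := Metric.closedBall 0 R
  have hwin : ∀ f ∈ S, ∀ n, (fun k : Fin 4 => f (n + k)) ∈ Metric.closedBall (0 : Fin 4 → ℂ) R := by
    intro f hf n
    rw [mem_closedBall_zero_iff] at hf ⊢
    exact (pi_norm_le_iff_of_nonneg hR).2 fun k => (f.norm_coe_le_norm _).trans hf
  let T : S → S := fun f =>
    ⟨BoundedContinuousFunction.ofNormedAddCommGroup (fun n => Φ n fun k => f.1 (n + k))
      continuous_of_discreteTopology R fun n => hmaps n _ (hwin f.1 f.2 n),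
      mem_closedBall_zero_iff.2 <| (BoundedContinuousFunction.norm_le hR).2
        fun n => hmaps n _ (hwin f.1 f.2 n)⟩
  have hT : ContractingWith ⟨K, hK⟩ T := by
    refine ⟨by exact_mod_cast hK1, LipschitzWith.of_dist_le_mul fun f g => ?_⟩
    rw [Subtype.dist_eq, Subtype.dist_eq]
    refine (BoundedContinuousFunction.dist_le (by positivity)).2 fun n => ?_
    rw [dist_eq_norm]
    refine (hlip n _ (hwin f.1 f.2 n) _ (hwin g.1 g.2 n)).trans ?_
    refine mul_le_mul_of_nonneg_left ?_ hK
    refine (pi_norm_le_iff_of_nonneg dist_nonneg).2 fun k => ?_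
    rw [Pi.sub_apply, ← dist_eq_norm]
    exact BoundedContinuousFunction.dist_coe_le_dist _
  have : CompleteSpace S := (Metric.isClosed_closedBall.isComplete).completeSpace_coe
  have : Nonempty S := ⟨⟨0, Metric.mem_closedBall_self hR⟩⟩
  have hfix := hT.fixedPoint_isFixedPt
  set f := ContractingWith.fixedPoint T hT
  refine ⟨f.1, fun n => (f.1.norm_coe_le_norm n).trans (mem_closedBall_zero_iff.1 f.2), fun n => ?_⟩
  exact (congrArg (fun g : S => g.1 n) hfix).symm

/-- Perturbed version: `A` is globally contracting, `Q` is smooth, and the perturbation is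
multiplied by a null sequence `u`. -/
theorem exists_bounded_solution_of_perturbation {κ : ℝ} (hκ : 0 ≤ κ) (hκ1 : κ < 1)
    (A : (Fin 4 → ℂ) → ℂ) (hA : ∀ v w, ‖A v - A w‖ ≤ κ * ‖v - w‖)
    (Q : ℂ × (Fin 4 → ℂ) → ℂ) (hQ : ContDiff ℂ 1 Q)
    (u : ℕ → ℂ) (hu : Filter.Tendsto u Filter.atTop (nhds 0)) :
    ∃ R : ℝ, ∀ᶠ N in Filter.atTop, ∃ f : ℕ → ℂ, (∀ n, ‖f n‖ ≤ R) ∧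
      ∀ n, f n = A (fun k => f (n + k)) + u (N + n) * Q (u (N + n), fun k => f (n + k)) := by
  -- With this `R` the map `A` sends the ball into the disk of radius `R - 1`, leaving room 1 for
  -- the perturbation.
  set R : ℝ := (‖A 0‖ + 1) / (1 - κ) with hRdef
  have h1κ : 0 < 1 - κ := by linarith
  have hR : 0 ≤ R := by positivity
  have hReq : κ * R + ‖A 0‖ + 1 = R := by
    rw [hRdef]; field_simp; ring
  set s : Set (ℂ × (Fin 4 → ℂ)) := Metric.closedBall 0 1 ×ˢ Metric.closedBall 0 R
  have hs : IsCompact s := (isCompact_closedBall _ _).prod (isCompact_closedBall _ _)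
  obtain ⟨L, hL⟩ :=
    (hQ.locallyLipschitz.locallyLipschitzOn (s := s)).exists_lipschitzOnWith_of_compact hs
  obtain ⟨M, hM⟩ := hs.exists_bound_of_continuousOn hQ.continuous.continuousOn
  -- The three bounds keep `u` in the unit disk, the perturbation below 1, and its Lipschitz
  -- constant below `(1 - κ) / 2`, for a total of `(1 + κ) / 2`.
  set ε : ℝ := min 1 (min (1 / (1 + |M|)) ((1 - κ) / 2 / (1 + L)))
  have hε : 0 < ε := by positivity
  refine ⟨R, ?_⟩
  obtain ⟨N₀, hN₀⟩ := Filter.eventually_atTop.1 (Metric.tendsto_nhds.1 hu ε hε)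
  refine Filter.eventually_atTop.2 ⟨N₀, fun N hN => ?_⟩
  have hle : ∀ n, ‖u (N + n)‖ ≤ ε := fun n => by
    simpa using (hN₀ (N + n) (by omega)).le
  have hmem : ∀ n, ∀ v ∈ Metric.closedBall (0 : Fin 4 → ℂ) R, (u (N + n), v) ∈ s := fun n v hv =>
    ⟨mem_closedBall_zero_iff.2 ((hle n).trans (min_le_left _ _)), hv⟩
  refine exists_bounded_solution_of_contracting (K := (1 + κ) / 2) (by linarith) (by linarith) hR
    (fun n v => A v + u (N + n) * Q (u (N + n), v)) ?_ ?_
  · intro n v hv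
    have hAv : ‖A v‖ ≤ κ * R + ‖A 0‖ := by
      have h1 := hA v 0
      rw [sub_zero] at h1
      have h2 := norm_le_norm_add_norm_sub' (A v) (A 0)
      have h3 := mul_le_mul_of_nonneg_left (mem_closedBall_zero_iff.1 hv) hκ
      linarith
    have hQv : ‖u (N + n) * Q (u (N + n), v)‖ ≤ 1 := by
      rw [norm_mul]
      calc _ ≤ 1 / (1 + |M|) * (1 + |M|) := by
            refine mul_le_mul ?_ ?_ (norm_nonneg _) (by positivity)
            · exact (hle n).trans ((min_le_right _ _).trans (min_le_left _ _))
            · linarith [hM _ (hmem n v hv), le_abs_self M]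
        _ = 1 := by field_simp
    linarith [norm_add_le (A v) (u (N + n) * Q (u (N + n), v))]
  · intro n v hv w hw
    have hQvw : ‖u (N + n) * (Q (u (N + n), v) - Q (u (N + n), w))‖ ≤ (1 - κ) / 2 * ‖v - w‖ := by
      have h1 := hL.dist_le_mul _ (hmem n v hv) _ (hmem n w hw)
      rw [dist_eq_norm, Prod.dist_eq, dist_self, max_eq_right dist_nonneg, dist_eq_norm] at h1
      rw [norm_mul]
      calc _ ≤ (1 - κ) / 2 / (1 + L) * ((1 + L) * ‖v - w‖) := by
            refine mul_le_mul ?_ ?_ (norm_nonneg _) (by positivity)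
            · exact (hle n).trans ((min_le_right _ _).trans (min_le_right _ _))
            · linarith [norm_nonneg (v - w)]
        _ = _ := by field_simp
    calc _ = ‖(A v - A w) + u (N + n) * (Q (u (N + n), v) - Q (u (N + n), w))‖ := by
          congr 1; ring
      _ ≤ _ := by linarith [norm_add_le (A v - A w)
                    (u (N + n) * (Q (u (N + n), v) - Q (u (N + n), w))), hA v w]

/-! ### The ratio of the escaping orbit -/

/-- A monic complex polynomial of degree `n` whose value at `z` is smaller than `ε ^ n` has a root
at distance less than `ε` from `z`. -/
theorem exists_root_near_of_norm_eval_lt {q : ℂ[X]} (hq : q.Monic) {z : ℂ} {ε : ℝ} (hε : 0 ≤ ε)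
    (h : ‖q.eval z‖ < ε ^ q.natDegree) : ∃ r, q.IsRoot r ∧ ‖r - z‖ < ε := by
  by_contra! hfar
  have hsplit := IsAlgClosed.splits q
  refine h.not_ge ?_
  have heval : q.eval z = (q.roots.map fun r => z - r).prod := by
    conv_lhs => rw [hsplit.eq_prod_roots_of_monic hq]
    simp [eval_multiset_prod, Multiset.map_map]
  rw [hsplit.natDegree_eq_card_roots, heval]
  have hmem : ∀ r ∈ q.roots, ε ≤ ‖z - r‖ := fun r hr => by
    rw [norm_sub_rev]; exact hfar r (isRoot_of_mem_roots hr)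
  generalize q.roots = s at hmem
  induction s using Multiset.induction_on with
  | empty => simp
  | cons a s ih =>
    rw [Multiset.map_cons, Multiset.prod_cons, norm_mul, Multiset.card_cons, pow_succ']
    exact mul_le_mul (hmem a (Multiset.mem_cons_self a s))
      (ih fun r hr => hmem r (Multiset.mem_cons_of_mem hr)) (by positivity) (norm_nonneg _)

theorem norm_le_of_abs_re_le_of_abs_im_le {z : ℂ} {a b c : ℝ} (hc : 0 ≤ c) (hre : |z.re| ≤ a)
    (him : |z.im| ≤ b) (h : a ^ 2 + b ^ 2 ≤ c ^ 2) : ‖z‖ ≤ c := by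
  rw [← abs_of_nonneg hc, ← abs_of_nonneg (norm_nonneg z), ← sq_le_sq, ← Complex.normSq_eq_norm_sq,
    Complex.normSq_apply]
  have h1 := pow_le_pow_left₀ (abs_nonneg _) hre 2
  have h2 := pow_le_pow_left₀ (abs_nonneg _) him 2
  rw [sq_abs] at h1 h2
  linarith

/-- Error propagation for products of complex numbers. -/
theorem norm_mul_sub_le {a b a₀ b₀ : ℂ} {α β A B : ℝ} (ha : ‖a - a₀‖ ≤ α) (hb : ‖b - b₀‖ ≤ β)
    (hA : ‖a₀‖ ≤ A) (hB : ‖b₀‖ ≤ B) : ‖a * b - a₀ * b₀‖ ≤ α * (B + β) + A * β := by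
  have hα := (norm_nonneg _).trans ha
  have hA0 := (norm_nonneg _).trans hA
  have hbn : ‖b‖ ≤ B + β := by linarith [norm_le_norm_add_norm_sub' b b₀]
  calc _ = ‖(a - a₀) * b + a₀ * (b - b₀)‖ := by congr 1; ring
    _ ≤ ‖a - a₀‖ * ‖b‖ + ‖a₀‖ * ‖b - b₀‖ := by
      simpa only [norm_mul] using norm_add_le ((a - a₀) * b) (a₀ * (b - b₀))
    _ ≤ _ := by gcongr

/-- The quintic is what remains of `d₁ d₂ d₃ - 1` after division by `-μ`. The decimals are accurate
enough for the residual to be below `(1 / 1000) ^ 5`, as the root-proximity lemma requires. -/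
theorem exists_quintic_root :
    ∃ μ : ℂ, μ ^ 5 - μ ^ 4 - μ ^ 3 + μ + 1 = 0 ∧
      ‖μ - ⟨1.2992427112412628713, 0.3656527594469783701⟩‖ ≤ 1 / 1000 := by
  set q : ℂ[X] := X ^ 5 - X ^ 4 - X ^ 3 + X + 1 with hq
  have hdeg : q.natDegree = 5 := by rw [hq]; compute_degree!
  have hmonic : q.Monic := by rw [hq]; monicity!
  obtain ⟨μ, hμ, hdist⟩ := exists_root_near_of_norm_eval_lt hmonic
    (z := ⟨1.2992427112412628713, 0.3656527594469783701⟩) (ε := 1 / 1000) (by norm_num) (by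
      rw [hdeg]
      refine lt_of_le_of_lt (norm_le_of_abs_re_le_of_abs_im_le (a := 1 / 10 ^ 16)
        (b := 1 / 10 ^ 16) (c := 1 / 10 ^ 15 / 2) (by norm_num) ?_ ?_ (by norm_num)) (by norm_num)
      · simp [hq, pow_succ, abs_le]; norm_num
      · simp [hq, pow_succ, abs_le]; norm_num)
  exact ⟨μ, by simpa [hq] using hμ, hdist.le⟩

/-- With `d_k = 1 - μ ^ k`, the sequence `μ ^ n` solves the recurrence of the method for `z ^ 3`
iff `d₁ d₂ d₃ = 1`; the last estimate expresses that the linearised recurrence is contracting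
backwards. -/
theorem exists_ratio : ∃ μ : ℂ, 1 < ‖μ‖ ∧ (1 - μ) * (1 - μ ^ 2) * (1 - μ ^ 3) = 1 ∧
    ‖(1 - μ ^ 2) * (1 - μ ^ 3)‖ + ‖(1 - μ) * (1 - μ ^ 3)‖ + ‖(1 - μ) * (1 - μ ^ 2)‖ ≤
      9 / 10 * ‖(1 - μ ^ 2) * (1 - μ ^ 3) + (1 - μ) * (1 - μ ^ 3) + (1 - μ) * (1 - μ ^ 2) - 3‖ := by
  obtain ⟨μ, hμ, hdist⟩ := exists_quintic_root
  set z : ℂ := ⟨1.2992427112412628713, 0.3656527594469783701⟩ with hz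
  have hzn : ‖z‖ ≤ 1.36 :=
    norm_le_of_abs_re_le_of_abs_im_le (a := 1.3) (b := 0.37) (by norm_num)
      (by simp [hz, abs_le]; norm_num) (by simp [hz, abs_le]; norm_num) (by norm_num)
  have h1 : ‖(1 - μ) - (1 - z)‖ ≤ 1 / 1000 := by
    rw [norm_sub_rev]; simpa using hdist
  have h2' : ‖μ * μ - z * z‖ ≤ 3 / 1000 :=
    (norm_mul_sub_le hdist hdist hzn hzn).trans (by norm_num)
  have hz2n : ‖z * z‖ ≤ 1.85 := by
    rw [norm_mul]; nlinarith [norm_nonneg z]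
  have h3' : ‖μ * μ * μ - z * z * z‖ ≤ 7 / 1000 :=
    (norm_mul_sub_le h2' hdist hz2n hzn).trans (by norm_num)
  have h2 : ‖(1 - μ ^ 2) - (1 - z * z)‖ ≤ 3 / 1000 := by
    rw [norm_sub_rev]; simpa [pow_succ] using h2'
  have h3 : ‖(1 - μ ^ 3) - (1 - z * z * z)‖ ≤ 7 / 1000 := by
    rw [norm_sub_rev]; simpa [pow_succ] using h3'
  have n1 : ‖1 - z‖ ≤ 0.5 :=
    norm_le_of_abs_re_le_of_abs_im_le (a := 0.3) (b := 0.37) (by norm_num)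
      (by simp [hz, abs_le]; norm_num) (by simp [hz, abs_le]; norm_num) (by norm_num)
  have n2 : ‖1 - z * z‖ ≤ 1.2 :=
    norm_le_of_abs_re_le_of_abs_im_le (a := 0.56) (b := 0.96) (by norm_num)
      (by simp [hz, abs_le]; norm_num) (by simp [hz, abs_le]; norm_num) (by norm_num)
  have n3 : ‖1 - z * z * z‖ ≤ 2 :=
    norm_le_of_abs_re_le_of_abs_im_le (a := 0.68) (b := 1.81) (by norm_num)
      (by simp [hz, abs_le]; norm_num) (by simp [hz, abs_le]; norm_num) (by norm_num)
  -- Each product moves by at most 0.02 between `z` and `μ`, so the required inequality follows from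
  -- `2.2 + 0.95 + 0.55 + 0.06 ≤ 9 / 10 * 4.8`.
  have h23 := (norm_mul_sub_le h2 h3 n2 n3).trans (show _ ≤ (0.02 : ℝ) by norm_num)
  have h13 := (norm_mul_sub_le h1 h3 n1 n3).trans (show _ ≤ (0.02 : ℝ) by norm_num)
  have h12 := (norm_mul_sub_le h1 h2 n1 n2).trans (show _ ≤ (0.02 : ℝ) by norm_num)
  have n23 : ‖(1 - z * z) * (1 - z * z * z)‖ ≤ 2.2 :=
    norm_le_of_abs_re_le_of_abs_im_le (a := 1.35) (b := 1.65) (by norm_num)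
      (by simp [hz, abs_le]; norm_num) (by simp [hz, abs_le]; norm_num) (by norm_num)
  have n13 : ‖(1 - z) * (1 - z * z * z)‖ ≤ 0.95 :=
    norm_le_of_abs_re_le_of_abs_im_le (a := 0.46) (b := 0.79) (by norm_num)
      (by simp [hz, abs_le]; norm_num) (by simp [hz, abs_le]; norm_num) (by norm_num)
  have n12 : ‖(1 - z) * (1 - z * z)‖ ≤ 0.55 :=
    norm_le_of_abs_re_le_of_abs_im_le (a := 0.19) (b := 0.49) (by norm_num)
      (by simp [hz, abs_le]; norm_num) (by simp [hz, abs_le]; norm_num) (by norm_num)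
  refine ⟨μ, ?_, by linear_combination (-μ) * hμ, ?_⟩
  · have : (1.29 : ℝ) ≤ ‖z‖ :=
      le_trans (by simp [hz]; norm_num) ((le_abs_self z.re).trans (Complex.abs_re_le_norm z))
    rw [norm_sub_rev] at hdist
    linarith [norm_le_norm_add_norm_sub' z μ]
  · set a := (1 - μ ^ 2) * (1 - μ ^ 3)
    set b := (1 - μ) * (1 - μ ^ 3)
    set c := (1 - μ) * (1 - μ ^ 2)
    set a₀ := (1 - z * z) * (1 - z * z * z) with ha₀
    set b₀ := (1 - z) * (1 - z * z * z) with hb₀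
    set c₀ := (1 - z) * (1 - z * z) with hc₀
    have hre : (a₀ + b₀ + c₀ - 3).re ≤ -4.9 := by
      simp [ha₀, hb₀, hc₀, hz]; norm_num
    have hG : 4.8 ≤ ‖a + b + c - 3‖ := by
      have e1 := (Complex.re_le_norm (a - a₀)).trans h23
      have e2 := (Complex.re_le_norm (b - b₀)).trans h13
      have e3 := (Complex.re_le_norm (c - c₀)).trans h12
      have e4 := Complex.abs_re_le_norm (a + b + c - 3)
      have e5 := neg_abs_le (a + b + c - 3).re
      simp only [Complex.add_re, Complex.sub_re] at *
      linarith
    linarith [norm_le_norm_add_norm_sub' a a₀, norm_le_norm_add_norm_sub' b b₀,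
      norm_le_norm_add_norm_sub' c c₀]

/-! ### Escaping solutions of the scalar recurrence -/

theorem eval_of_monic_of_natDegree_eq_three {p : ℂ[X]} (hmonic : p.Monic) (hdeg : p.natDegree = 3)
    (z : ℂ) :
    p.eval z = z ^ 3 + p.coeff 2 * z ^ 2 + p.coeff 1 * z + p.coeff 0 := by
  have h3 : p.coeff 3 = 1 := by rw [← hdeg]; exact hmonic
  rw [eval_eq_sum_range, hdeg]
  simp [Finset.sum_range_succ, h3]
  ring

/-- The Gauss–Seidel Weierstrass method for a monic cubic `p` is the third iterate of
`(a, b, c) ↦ (b, c, a')` with `(a - b) (a - c) (a - a') = p a`; this recurrence has solutions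
tending to infinity with pairwise distinct nearby terms. -/
theorem exists_escaping_solution {p : ℂ[X]} (hmonic : p.Monic) (hdeg : p.natDegree = 3) :
    ∃ w : ℕ → ℂ, (∀ n, w n ≠ w (n + 1)) ∧ (∀ n, w n ≠ w (n + 2)) ∧
      (∀ n, (w n - w (n + 1)) * (w n - w (n + 2)) * (w n - w (n + 3)) = p.eval (w n)) ∧
      Filter.Tendsto w Filter.atTop (Bornology.cobounded ℂ) := by
  obtain ⟨μ, hμ1, hd, hκ⟩ := exists_ratio
  have hμ0 : μ ≠ 0 := by rintro rfl; norm_num at hμ1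
  set d₁ := 1 - μ with hd₁
  set d₂ := 1 - μ ^ 2 with hd₂
  set d₃ := 1 - μ ^ 3 with hd₃
  set G := d₂ * d₃ + d₁ * d₃ + d₁ * d₂ - 3 with hG
  have hd₁0 : d₁ ≠ 0 := by rintro h; simp [h] at hd
  have hd₂0 : d₂ ≠ 0 := by rintro h; simp [h] at hd
  have hG0 : G ≠ 0 := by
    intro h
    rw [h, norm_zero, mul_zero] at hκ
    have h12 : ‖d₁ * d₂‖ ≤ 0 := by
      linarith [norm_nonneg (d₂ * d₃), norm_nonneg (d₁ * d₃)]
    exact mul_ne_zero hd₁0 hd₂0 (norm_le_zero_iff.1 h12)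
  have hGn : 0 < ‖G‖ := norm_pos_iff.2 hG0
  set α := p.coeff 2
  set β := p.coeff 1
  set γ := p.coeff 0
  -- Substitute `w n = m + f n` with `m = μ ^ (N + n)`. The `m ^ 3` terms cancel, the `m ^ 2` terms
  -- give `G * f n = G * A`, and the lower ones, divided by `m ^ 2`, give `u * Q` with `u = m⁻¹`.
  let A : (Fin 4 → ℂ) → ℂ := fun v =>
    (d₂ * d₃ * v 1 + d₁ * d₃ * v 2 + d₁ * d₂ * v 3 + α) / G
  let Q : ℂ × (Fin 4 → ℂ) → ℂ := fun x =>
    -(d₁ * (x.2 0 - x.2 2) * (x.2 0 - x.2 3) + d₂ * (x.2 0 - x.2 1) * (x.2 0 - x.2 3)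
      + d₃ * (x.2 0 - x.2 1) * (x.2 0 - x.2 2) - 3 * x.2 0 ^ 2 - 2 * α * x.2 0 - β
      + x.1 * ((x.2 0 - x.2 1) * (x.2 0 - x.2 2) * (x.2 0 - x.2 3)
        - (x.2 0 ^ 3 + α * x.2 0 ^ 2 + β * x.2 0 + γ))) / G
  have hA : ∀ v w, ‖A v - A w‖ ≤ 9 / 10 * ‖v - w‖ := by
    intro v w
    have hk : ∀ k, ‖v k - w k‖ ≤ ‖v - w‖ := fun k => norm_le_pi_norm (v - w) k
    have : A v - A w = (d₂ * d₃ * (v 1 - w 1) + d₁ * d₃ * (v 2 - w 2) + d₁ * d₂ * (v 3 - w 3)) / G := by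
      simp only [A]; ring
    rw [this, norm_div, div_le_iff₀ hGn]
    calc _ ≤ ‖d₂ * d₃ * (v 1 - w 1)‖ + ‖d₁ * d₃ * (v 2 - w 2)‖ + ‖d₁ * d₂ * (v 3 - w 3)‖ :=
          norm_add₃_le
      _ ≤ ‖d₂ * d₃‖ * ‖v - w‖ + ‖d₁ * d₃‖ * ‖v - w‖ + ‖d₁ * d₂‖ * ‖v - w‖ := by
          rw [norm_mul (d₂ * d₃), norm_mul (d₁ * d₃), norm_mul (d₁ * d₂)]
          gcongr <;> apply hk
      _ = (‖d₂ * d₃‖ + ‖d₁ * d₃‖ + ‖d₁ * d₂‖) * ‖v - w‖ := by ring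
      _ ≤ (9 / 10 * ‖G‖) * ‖v - w‖ := by gcongr
      _ = _ := by ring
  have hQ : ContDiff ℂ 1 Q := by
    simp only [Q]
    fun_prop
  have hu : Filter.Tendsto (fun n => μ⁻¹ ^ n) Filter.atTop (nhds 0) :=
    tendsto_pow_atTop_nhds_zero_of_norm_lt_one (by rw [norm_inv]; exact inv_lt_one_of_one_lt₀ hμ1)
  obtain ⟨R, hR⟩ :=
    exists_bounded_solution_of_perturbation (by norm_num) (by norm_num) A hA Q hQ _ hu
  have hpow : Filter.Tendsto (fun n : ℕ => ‖μ‖ ^ n) Filter.atTop Filter.atTop :=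
    tendsto_pow_atTop_atTop_of_one_lt hμ1
  obtain ⟨N, ⟨f, hfR, hf⟩, hN₁, hN₂⟩ := (hR.and
    ((hpow.eventually_gt_atTop (2 * R / ‖d₁‖)).and (hpow.eventually_gt_atTop (2 * R / ‖d₂‖)))).exists
  -- The gap `d * μ ^ (N + n)` between the leading terms exceeds `2 * R`, the most that `f` can
  -- compensate.
  have hne : ∀ n k (d : ℂ), d ≠ 0 → d = 1 - μ ^ k → 2 * R / ‖d‖ < ‖μ‖ ^ N →
      μ ^ (N + n) + f n ≠ μ ^ (N + (n + k)) + f (n + k) := by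
    intro n k d hd0 hdk hlt heq
    have h1 : d * μ ^ (N + n) = f (n + k) - f n := by
      rw [hdk]; linear_combination heq
    have h2 : ‖d‖ * ‖μ‖ ^ N ≤ 2 * R := by
      calc _ ≤ ‖d‖ * ‖μ‖ ^ (N + n) := by
            gcongr
            · exact hμ1.le
            · omega
        _ = ‖f (n + k) - f n‖ := by rw [← h1, norm_mul, norm_pow]
        _ ≤ 2 * R := by linarith [norm_sub_le (f (n + k)) (f n), hfR n, hfR (n + k)]
    rw [div_lt_iff₀ (norm_pos_iff.2 hd0)] at hlt
    linarith
  refine ⟨fun n => μ ^ (N + n) + f n, fun n => hne n 1 d₁ hd₁0 (by simp [hd₁]) hN₁,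
    fun n => hne n 2 d₂ hd₂0 hd₂ hN₂, fun n => ?_, ?_⟩
  · rw [eval_of_monic_of_natDegree_eq_three hmonic hdeg]
    have hfn := hf n
    have hm : μ ^ (N + n) ≠ 0 := pow_ne_zero _ hμ0
    have hmk : ∀ k, μ ^ (N + (n + k)) = μ ^ (N + n) * μ ^ k := fun k => by ring
    simp only [hmk]
    simp only [A, Q, inv_pow, Fin.val_zero, Fin.val_one, Fin.val_two, add_zero,
      show ((3 : Fin 4) : ℕ) = 3 from rfl] at hfn
    set m := μ ^ (N + n)
    generalize f n = a at *
    generalize f (n + 1) = b at *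
    generalize f (n + 2) = c at *
    generalize f (n + 3) = e at *
    field_simp at hfn
    rw [hG] at hfn
    have hμa : μ = 1 - d₁ := by rw [hd₁]; ring
    have hμb : μ ^ 2 = 1 - d₂ := by rw [hd₂]; ring
    have hμc : μ ^ 3 = 1 - d₃ := by rw [hd₃]; ring
    rw [pow_one, hμb, hμc, hμa]
    clear_value d₁ d₂ d₃ m
    linear_combination hfn + m ^ 3 * hd
  · rw [← tendsto_norm_atTop_iff_cobounded]
    refine Filter.tendsto_atTop_mono (f := fun n => ‖μ‖ ^ n + -R) (fun n => ?_)
      (Filter.tendsto_atTop_add_const_right _ _ hpow)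
    have h1 : ‖μ‖ ^ n ≤ ‖μ ^ (N + n)‖ := by
      rw [norm_pow]; exact pow_le_pow_right₀ hμ1.le (by omega)
    have h2 := norm_sub_le (μ ^ (N + n) + f n) (f n)
    rw [add_sub_cancel_right] at h2
    linarith [hfR n]

/-! ### The Gauss–Seidel sweep in dimension three -/

theorem gswStage_succ_eq_update {n : ℕ} (p : ℂ[X]) (z : Fin n → ℂ) (i : Fin n) :
    gswStage p z (i + 1) =
      Function.update (gswStage p z i) i (weierstrassUpdate p (gswStage p z i) i) := by
  rw [gswStage, dif_pos i.2]

theorem weierstrassUpdate_eq_of_mul_eq {p : ℂ[X]} {z : Fin 3 → ℂ} {i j k : Fin 3} {a : ℂ}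
    (hu : Finset.univ.erase i = {j, k}) (hjk : j ≠ k) (hj : z i ≠ z j) (hk : z i ≠ z k)
    (h : (z i - z j) * (z i - z k) * (z i - a) = p.eval (z i)) : weierstrassUpdate p z i = a := by
  have hj' := sub_ne_zero.2 hj
  have hk' := sub_ne_zero.2 hk
  rw [weierstrassUpdate, hu, Finset.prod_pair hjk, ← h]
  field_simp
  ring

/-- Three consecutive steps of the scalar recurrence make up one sweep. -/
theorem gswDefinedAt_and_gsw_eq_of_recurrence {p : ℂ[X]} {w : ℕ → ℂ}
    (h1 : ∀ n, w n ≠ w (n + 1)) (h2 : ∀ n, w n ≠ w (n + 2))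
    (hrec : ∀ n, (w n - w (n + 1)) * (w n - w (n + 2)) * (w n - w (n + 3)) = p.eval (w n))
    (n : ℕ) :
    gswDefinedAt p ![w n, w (n + 1), w (n + 2)] ∧
      gsw p ![w n, w (n + 1), w (n + 2)] = ![w (n + 3), w (n + 4), w (n + 5)] := by
  generalize hz : ![w n, w (n + 1), w (n + 2)] = z
  have s0 : gswStage p z (0 : Fin 3) = ![w n, w (n + 1), w (n + 2)] := hz.symm
  have s1 : gswStage p z (1 : Fin 3) = ![w (n + 3), w (n + 1), w (n + 2)] := by
    refine (gswStage_succ_eq_update p z 0).trans ?_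
    rw [s0, weierstrassUpdate_eq_of_mul_eq (i := 0) (j := 1) (k := 2) (a := w (n + 3))
      (by decide) (by decide) (h1 n) (h2 n)
      (by simpa using hrec n)]
    funext i; fin_cases i <;> simp
  have s2 : gswStage p z (2 : Fin 3) = ![w (n + 3), w (n + 4), w (n + 2)] := by
    refine (gswStage_succ_eq_update p z 1).trans ?_
    -- The other coordinates are taken in cyclic order, because coordinate 0 already holds the later
    -- term `w (n + 3)`.
    rw [s1, weierstrassUpdate_eq_of_mul_eq (i := 1) (j := 2) (k := 0) (a := w (n + 4))
      (by decide) (by decide) (h1 (n + 1)) (h2 (n + 1))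
      (by simpa using hrec (n + 1))]
    funext i; fin_cases i <;> simp
  have s3 : gswStage p z 3 = ![w (n + 3), w (n + 4), w (n + 5)] := by
    refine (gswStage_succ_eq_update p z 2).trans ?_
    rw [s2, weierstrassUpdate_eq_of_mul_eq (i := 2) (j := 0) (k := 1) (a := w (n + 5))
      (by decide) (by decide) (h1 (n + 2)) (h2 (n + 2))
      (by simpa using hrec (n + 2))]
    funext i; fin_cases i <;> simp
  refine ⟨?_, s3⟩
  intro i
  have hcases : i = 0 ∨ i = 1 ∨ i = 2 := by revert i; decide
  rcases hcases with rfl | rfl | rfl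
  · rw [s0]
    intro j hj
    fin_cases j
    exacts [absurd rfl hj, h1 n, h2 n]
  · rw [s1]
    intro j hj
    fin_cases j
    exacts [h2 (n + 1), absurd rfl hj, h1 (n + 1)]
  · rw [s2]
    intro j hj
    fin_cases j
    exacts [h1 (n + 2), h2 (n + 2), absurd rfl hj]

theorem mainTheorem4 (p : ℂ[X]) (hmonic : p.Monic) (hdeg : p.natDegree = 3)
    (hroots : p.roots.Nodup) :
    ∃ z : ℕ → Fin 3 → ℂ, IsGSWOrbit p z ∧
      ∀ i : Fin 3, Filter.Tendsto (fun k : ℕ => z k i) Filter.atTop (Bornology.cobounded ℂ) := by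
  obtain ⟨w, h1, h2, hrec, hlim⟩ := exists_escaping_solution hmonic hdeg
  refine ⟨fun k => ![w (3 * k), w (3 * k + 1), w (3 * k + 2)], fun k => ?_, fun i => ?_⟩
  · obtain ⟨hdef, hstep⟩ := gswDefinedAt_and_gsw_eq_of_recurrence h1 h2 hrec (3 * k)
    exact ⟨hdef, hstep.symm⟩
  · have hlim' : ∀ j, Filter.Tendsto (fun k => w (3 * k + j)) Filter.atTop
        (Bornology.cobounded ℂ) := fun j =>
      hlim.comp (Filter.tendsto_atTop_mono (f := fun k => k) (fun k => by omega)
        Filter.tendsto_id)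
    fin_cases i
    exacts [hlim' 0, hlim' 1, hlim' 2]
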